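/- For a topological space $X$ and a metric space $M$, let $C(X,M)$ be the set of continuous functions from $X$ to $M$. For $f\in C(X,M)$ let $\Omega_f$ be the union of all open $U\subseteq X$ such that $f$ is constant on $U$, and let $E_0(X,M)$ be the set of all $f\in C(X,M)$ such that $\Omega_f$ is dense in $X$. Let $\mathcal F_0$ be the class of all spaces with at most one point. For an ordinal $\alpha>0$, let $\mathcal F_\alpha$ be the class of all compact metric spaces $M$ for which there is a continuous $\varphi:M\to[0,1]$ such that $\varphi^{-1}\{r\}\in\bigcup_{\delta<\alpha}\mathcal F_\delta$ for every $r\in[0,1]$. Let $\mathcal F$ be the union of the classes $\mathcal F_\alpha$ over all ordinals $\alpha$. A uniform Eberlein compact is a space homeomorphic to a weakly compact subspace of a Hilbert space. Theorem 4.2. (a) If $X$ is compact Hausdorff, $E_0(X,\mathbb R)=C(X,\mathbb R)$, and $M\in\mathcal F$, then $E_0(X,M)=C(X,M)$. (b) There is a first countable uniform Eberlein compact $X$ such that $E_0(X,\mathbb R)=C(X,\mathbb R)$, but $E_0(X,M)\neq C(X,M)$ for all compact metric spaces $M\notin\mathcal F$. -/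

import Mathlib

universe u v

/-- `Ω_f`: the union of all open sets on which `f` is constant. -/
def locConstSet {X : Type u} {M : Type v} [TopologicalSpace X] (f : X → M) : Set X :=
  ⋃₀ {U : Set X | IsOpen U ∧ ∀ x ∈ U, ∀ y ∈ U, f x = f y}

/-- `E₀(X, M)`: the continuous functions `f : X → M` for which `Ω_f` is dense in `X`. -/
def E0 (X : Type u) (M : Type v) [TopologicalSpace X] [TopologicalSpace M] : Set C(X, M) :=
  {f | Dense (locConstSet f)}

/-- Membership of a space `M` in the class `𝓕_α`.  The class `𝓕_0` consists of the spaces with at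
most one point.  For `α > 0`, the class `𝓕_α` consists of the compact metrizable spaces `M` with a
continuous `φ : M → [0,1]` every fibre of which (with the subspace topology) is in `𝓕_δ` for some
`δ < α`. -/
def MemFLevel (α : Ordinal.{u}) (M : Type u) [TopologicalSpace M] : Prop :=
  (α = 0 ∧ Subsingleton M) ∨
    (0 < α ∧ CompactSpace M ∧ TopologicalSpace.MetrizableSpace M ∧
      ∃ φ : C(M, unitInterval), ∀ r : unitInterval,
        ∃ δ : Ordinal.{u}, ∃ _ : δ < α, MemFLevel δ (φ ⁻¹' {r} : Set M))
termination_by α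

/-- Membership of a space in the class `𝓕`, the union of all the `𝓕_α`. -/
def MemF (M : Type u) [TopologicalSpace M] : Prop :=
  ∃ α : Ordinal.{u}, MemFLevel α M

/-- A uniform Eberlein compact is a space homeomorphic to a weakly compact subspace of a Hilbert
space (`WeakSpace ℝ H` is `H` with its weak topology). -/
def IsUniformEberleinCompact (X : Type u) [TopologicalSpace X] : Prop :=
  ∃ (H : Type u) (_ : NormedAddCommGroup H) (_ : InnerProductSpace ℝ H) (_ : CompleteSpace H)
    (K : Set (WeakSpace ℝ H)), IsCompact K ∧ Nonempty (X ≃ₜ K)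

/-!
Part (a) is an induction along the classes `𝓕_α`. If `φ : M → [0,1]` has all its fibres in earlier
classes and `f : X → M` is continuous, then `φ ∘ f` is constant on some open subset of any given
open set, and on that subset `f` takes its values in a single fibre
(`MemFLevel.inter_locConstSet_nonempty`).

For part (b), call a closed subset of the Hilbert cube small if it is in `𝓕` (`FSet` is a form of
`𝓕` adapted to subsets of a fixed space). A set which is not small has a nonempty closed subset no
relatively open piece of which has small closure (`exists_nowhereFSet_subset`), because locally
small sets are small. Moreover, every continuous real function is constant on some subset of this
kind (`exists_subset_fibre`).

The space `X` is built along a tree of closed subsets `K s` of the Hilbert cube. Over each node `s`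
there is a copy of `K s × [1,2]`, and for every label `c ∈ [1,2]` a smaller copy of the whole
construction, which starts with a closed set `K (c :: s) ⊆ K s`, is attached to `K s × {c}` as a
clopen set. As labels tend to a limit `c`, the attached pieces converge to `K s × {c}`. Formally, a
point is a pair of a point of the Hilbert cube and a finite or infinite sequence of labels
(`Scheme.space`). Compactness, first countability and the embedding into `ℓ²` are visible from this
description. By compactness, for a continuous `g : X → ℝ` and all but countably many labels `c`,
the values of `g` on the piece attached at `c` are those on `K s × {c}`
(`Scheme.finite_children`). There are only continuum many continuous functions on `K s × [1,2]`, so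
the labels can be used to enumerate them, each one uncountably often in every interval, and
`K (c :: s)` can be chosen within a fibre of the function which `c` encodes. Then `g` is constant on
many of the attached pieces, which gives `E₀(X, ℝ) = C(X, ℝ)` (`Scheme.E0_real_eq_univ`).

A compact metrizable `M` outside `𝓕` embeds into the Hilbert cube, and some child `K [d]` of the
root lies in its image and is nowhere locally small, as then are all further sets below it. Over
this child the first coordinate is a map to `M` which is constant on no open set
(`Scheme.E0_ne_univ`).
-/

section

open Set Topology Filter

/-! ### Part (a): maps into spaces of the class `𝓕` -/

/-- An open set on which `f` is constant lies in `Ω_f`. -/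
theorem subset_locConstSet {X : Type u} {M : Type v} [TopologicalSpace X] {f : X → M} {U : Set X}
    (hU : IsOpen U) (hf : ∀ x ∈ U, ∀ y ∈ U, f x = f y) : U ⊆ locConstSet f :=
  subset_sUnion_of_mem ⟨hU, hf⟩

/-- Suppose that `E₀(X, ℝ) = C(X, ℝ)`. A continuous map which sends a nonempty open set `U` into a
closed copy of a space from `𝓕_α` is constant on some nonempty open subset of `U`. -/
theorem MemFLevel.inter_locConstSet_nonempty {X : Type u} [TopologicalSpace X]
    (hX : E0 X ℝ = univ) {M : Type v} [TopologicalSpace M] [NormalSpace M] (f : C(X, M))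
    (α : Ordinal.{v}) : ∀ (Y : Type v) [TopologicalSpace Y] (j : Y → M), MemFLevel α Y →
      IsClosedEmbedding j → ∀ U : Set X, IsOpen U → U.Nonempty → MapsTo f U (range j) →
        (U ∩ locConstSet f).Nonempty := by
  induction α using WellFoundedLT.induction with
  | ind α ih =>
    intro Y _ j hY hj U hU hne hfU
    rw [MemFLevel] at hY
    rcases hY with ⟨-, hs⟩ | ⟨-, -, -, φ, hφ⟩
    · obtain ⟨x, hx⟩ := hne
      refine ⟨x, hx, subset_locConstSet hU (fun a ha b hb => ?_) hx⟩
      obtain ⟨a', ha'⟩ := hfU ha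
      obtain ⟨b', hb'⟩ := hfU hb
      rw [← ha', ← hb', Subsingleton.elim a' b']
    · obtain ⟨ψ, hψ⟩ := ContinuousMap.exists_extension' hj
        ((⟨Subtype.val, continuous_subtype_val⟩ : C(unitInterval, ℝ)).comp φ)
      have hd : Dense (locConstSet (ψ.comp f)) := by
        have : ψ.comp f ∈ E0 X ℝ := hX ▸ mem_univ _
        exact this
      obtain ⟨x, hxU, V, ⟨hV, hVc⟩, hxV⟩ := hd.inter_open_nonempty U hU hne
      obtain ⟨y, hy⟩ := hfU hxU
      obtain ⟨δ, hδ, hmem⟩ := hφ (φ y)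
      obtain ⟨z, ⟨-, hzU⟩, hzΩ⟩ := ih δ hδ (φ ⁻¹' {φ y}) (fun a => j a) hmem
        (hj.comp ((isClosed_singleton.preimage φ.continuous).isClosedEmbedding_subtypeVal))
        (V ∩ U) (hV.inter hU) ⟨x, hxV, hxU⟩ (by
          rintro a ⟨haV, haU⟩
          obtain ⟨b, hb⟩ := hfU haU
          refine ⟨⟨b, ?_⟩, hb⟩
          have h1 : ψ (f a) = ψ (f x) := hVc a haV x hxV
          have h2 : ∀ c, ψ (j c) = (φ c : ℝ) := fun c => congrFun hψ c
          rw [← hb, ← hy, h2, h2] at h1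
          exact Subtype.ext h1)
      exact ⟨z, hzU, hzΩ⟩

theorem E0_eq_univ_of_memF {X : Type u} [TopologicalSpace X] (hX : E0 X ℝ = univ)
    {M : Type v} [MetricSpace M] (hM : MemF M) : E0 X M = univ := by
  obtain ⟨α, hα⟩ := hM
  refine eq_univ_of_forall fun f => ?_
  refine dense_iff_inter_open.2 fun U hU hne => ?_
  exact hα.inter_locConstSet_nonempty hX f α M id .id U hU hne (by simp)

/-! ### The class `𝓕` for subsets of a space -/

/-- A universe-free version of `𝓕` for subsets `H` of a fixed space `Y`: the least family
containing the sets with at most one point and every `H` admitting a continuous `φ : Y → ℝ` all of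
whose fibres within `H` belong to the family. -/
inductive FSet {Y : Type u} [TopologicalSpace Y] : Set Y → Prop
  | subsingleton (H : Set Y) (h : H.Subsingleton) : FSet H
  | fibres (H : Set Y) (φ : C(Y, ℝ)) (h : ∀ r, FSet (H ∩ φ ⁻¹' {r})) : FSet H

namespace FSet

variable {Y : Type u} [TopologicalSpace Y]

theorem mono {H : Set Y} (h : FSet H) : ∀ {H' : Set Y}, H' ⊆ H → FSet H' := by
  induction h with
  | subsingleton H h => exact fun hs => .subsingleton _ (h.anti hs)
  | fibres H φ _ ih => exact fun hs => .fibres _ φ fun r => ih r (inter_subset_inter_left _ hs)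

/-- A compact space with a closed embedding onto a set in the family `FSet` is in `𝓕`. -/
theorem memF {H : Set Y} (h : FSet H) : ∀ (Z : Type v) [TopologicalSpace Z] [CompactSpace Z]
    [TopologicalSpace.MetrizableSpace Z] (e : Z → Y), Continuous e → Function.Injective e →
    (∀ z, e z ∈ H) → MemF Z := by
  induction h with
  | subsingleton H h =>
    intro Z _ _ _ e _ hinj he
    refine ⟨0, ?_⟩
    rw [MemFLevel]
    exact .inl ⟨rfl, ⟨fun a b => hinj (h (he a) (he b))⟩⟩
  | fibres H φ _ ih =>
    intro Z _ _ _ e hc hinj he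
    -- Squeezing `ℝ` into `[0,1]` injectively does not change the fibres of `φ`.
    let σ : ℝ → unitInterval := unitInterval.sigmoid
    let ψ : C(Z, unitInterval) := ⟨fun z => σ (φ (e z)),
      unitInterval.continuous_sigmoid.comp (φ.continuous.comp hc)⟩
    have key : ∀ r : unitInterval, MemF (ψ ⁻¹' {r} : Set Z) := by
      intro r
      have : CompactSpace (ψ ⁻¹' {r} : Set Z) :=
        isCompact_iff_compactSpace.1 (isClosed_singleton.preimage ψ.continuous).isCompact
      by_cases hr : ∃ t, σ t = r
      · obtain ⟨t, rfl⟩ := hr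
        exact ih t _ (fun z => e z) (hc.comp continuous_subtype_val)
          (hinj.comp Subtype.val_injective)
          fun z => ⟨he z, unitInterval.sigmoid_injective z.2⟩
      · refine ⟨0, ?_⟩
        rw [MemFLevel]
        exact .inl ⟨rfl, ⟨fun a => (hr ⟨_, a.2⟩).elim⟩⟩
    choose α hα using key
    refine ⟨Order.succ (⨆ r, α r), ?_⟩
    rw [MemFLevel]
    refine .inr ⟨zero_le.trans_lt (Order.lt_succ _), ‹_›, ‹_›, ψ, fun r => ⟨α r, ?_, hα r⟩⟩
    exact Order.lt_succ_of_le (Ordinal.le_iSup α r)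

variable [TopologicalSpace.MetrizableSpace Y]

/-- If a closed part of `H` is in the family, and so are all closed sets in its complement, then so
is `H`: the fibres of the distance to the closed part are sets of these two kinds. -/
theorem of_closed_part {H A : Set Y} (hH : IsClosed H) (hA : IsClosed A) (hHA : FSet (H ∩ A))
    (h : ∀ B ⊆ H, IsClosed B → Disjoint B A → FSet B) : FSet H := by
  let _ := TopologicalSpace.metrizableSpaceMetric Y
  rcases A.eq_empty_or_nonempty with rfl | hne
  · exact h H subset_rfl hH (disjoint_empty _)
  refine .fibres _ ⟨fun x => Metric.infDist x A, Metric.continuous_infDist_pt A⟩ fun r => ?_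
  by_cases hr : r = 0
  · subst hr
    refine hHA.mono fun x hx => ⟨hx.1, ?_⟩
    exact (hA.mem_iff_infDist_zero hne).2 hx.2
  · refine h _ inter_subset_left
      (hH.inter (isClosed_singleton.preimage (Metric.continuous_infDist_pt A))) ?_
    refine disjoint_left.2 fun x hx hxA => hr ?_
    rw [← show Metric.infDist x A = r from hx.2]
    exact Metric.infDist_zero_of_mem hxA

theorem union {A B : Set Y} (hA : IsClosed A) (hB : IsClosed B) (h : FSet A) (h' : FSet B) :
    FSet (A ∪ B) :=
  of_closed_part (hA.union hB) hA (h.mono inter_subset_right) fun _ hC _ hd =>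
    h'.mono fun _ hx => (hC hx).resolve_left (disjoint_left.1 hd hx)

end FSet

/-- A nonempty closed set which is nowhere locally in `FSet`. -/
structure NowhereFSet {Y : Type u} [TopologicalSpace Y] (K : Set Y) : Prop where
  isClosed : IsClosed K
  nonempty : K.Nonempty
  not_fSet : ∀ x ∈ K, ∀ V ∈ 𝓝 x, IsClosed V → ¬ FSet (K ∩ V)

section kernel

variable {Y : Type u} [TopologicalSpace Y] [CompactSpace Y] [TopologicalSpace.MetrizableSpace Y]

/-- A closed set which is locally in `FSet` is in `FSet`. -/
theorem FSet.of_local {B : Set Y} (hB : IsClosed B)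
    (h : ∀ x ∈ B, ∃ V ∈ 𝓝 x, IsClosed V ∧ FSet (B ∩ V)) : FSet B := by
  suffices ∃ T, IsClosed T ∧ B ⊆ T ∧ FSet (B ∩ T) by
    obtain ⟨T, -, hT, h⟩ := this
    rwa [inter_eq_self_of_subset_left hT] at h
  refine hB.isCompact.induction_on (p := fun S => ∃ T, IsClosed T ∧ S ⊆ T ∧ FSet (B ∩ T))
    ⟨∅, isClosed_empty, subset_rfl, .subsingleton _ (by simp)⟩
    (fun S S' hS ⟨T, hT, hST, h⟩ => ⟨T, hT, hS.trans hST, h⟩) ?_ ?_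
  · rintro S S' ⟨T, hT, hST, h⟩ ⟨T', hT', hST', h'⟩
    refine ⟨T ∪ T', hT.union hT', union_subset_union hST hST', ?_⟩
    rw [inter_union_distrib_left]
    exact .union (hB.inter hT) (hB.inter hT') h h'
  · intro x hx
    obtain ⟨V, hV, hVc, h⟩ := h x hx
    exact ⟨V, mem_nhdsWithin_of_mem_nhds hV, V, hVc, subset_rfl, h⟩

/-- A Cantor–Bendixson type kernel: removing from a closed `H` outside `FSet` all points at which
`H` is locally in `FSet` leaves a nonempty closed set which is nowhere locally in `FSet`. -/
theorem exists_nowhereFSet_subset {H : Set Y} (hH : IsClosed H) (h : ¬ FSet H) :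
    ∃ K ⊆ H, NowhereFSet K := by
  let K : Set Y := {x ∈ H | ∀ V ∈ 𝓝 x, IsClosed V → ¬ FSet (H ∩ V)}
  have hKH : K ⊆ H := fun x hx => hx.1
  have hK : IsClosed K := by
    refine isClosed_of_closure_subset fun x hx => ⟨hH.closure_subset_iff.2 hKH hx, ?_⟩
    intro V hV hVc
    obtain ⟨y, hyV, hy⟩ := mem_closure_iff_nhds.1 hx _ (interior_mem_nhds.2 hV)
    exact hy.2 V (mem_interior_iff_mem_nhds.1 hyV) hVc
  -- Off the kernel, `H` is locally in `FSet`.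
  have hoff : ∀ V, IsClosed V → FSet (K ∩ V) → FSet (H ∩ V) := by
    intro V hV hKV
    refine .of_closed_part (hH.inter hV) hK (hKV.mono fun x hx => ⟨hx.2, hx.1.2⟩) ?_
    intro B hB hBc hd
    refine .of_local hBc fun x hx => ?_
    by_contra! hcon
    refine disjoint_left.1 hd hx ⟨(hB hx).1, fun W hW hWc hF => hcon W hW hWc (hF.mono ?_)⟩
    exact inter_subset_inter_left _ fun y hy => (hB hy).1
  refine ⟨K, hKH, hK, ?_, fun x hx V hV hVc hF => hx.2 V hV hVc (hoff V hVc hF)⟩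
  by_contra hemp
  rw [not_nonempty_iff_eq_empty] at hemp
  refine h ?_
  simpa using hoff univ isClosed_univ (by rw [hemp]; exact .subsingleton _ (by simp))

/-- On some nonempty closed subset of `L` the function `φ` is constant; if `L` is not in `FSet` this
subset can be chosen nowhere locally in `FSet`. -/
theorem exists_subset_fibre {L : Set Y} (hL : IsClosed L) (hne : L.Nonempty) (φ : C(Y, ℝ)) :
    ∃ K ⊆ L, IsClosed K ∧ K.Nonempty ∧ (∃ r, ∀ y ∈ K, φ y = r) ∧ (¬ FSet L → NowhereFSet K) := by
  by_cases hF : FSet L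
  · obtain ⟨x, hx⟩ := hne
    exact ⟨{x}, by simpa, isClosed_singleton, by simp, ⟨φ x, by simp⟩, fun h => (h hF).elim⟩
  · have : ∃ r, ¬ FSet (L ∩ φ ⁻¹' {r}) := by
      by_contra! h
      exact hF (.fibres _ φ h)
    obtain ⟨r, hr⟩ := this
    obtain ⟨K, hKL, hK⟩ := exists_nowhereFSet_subset
      (hL.inter (isClosed_singleton.preimage φ.continuous)) hr
    exact ⟨K, fun x hx => (hKL hx).1, hK.isClosed, hK.nonempty, ⟨r, fun y hy => (hKL hy).2⟩,
      fun _ => hK⟩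

end kernel

/-! ### A scheme of closed sets -/

open Cardinal in
theorem mk_le_continuum_of_completeSpace (Z : Type) [MetricSpace Z] [CompleteSpace Z]
    [SecondCountableTopology Z] [Nonempty Z] : #Z ≤ 𝔠 := by
  obtain ⟨f, -, hf⟩ := exists_nat_nat_continuous_surjective_of_completeSpace Z
  simpa using mk_le_of_surjective hf

open Cardinal in
/-- A set of cardinality at most the continuum is the image of `ℝ` under a map with all fibres
uncountable in every interval. Such a map factors through `ℝ / ℚ`: every class is dense, and each
value is assigned to uncountably many classes. -/
theorem exists_uncountable_fibres (Z : Type) [Nonempty Z] (hZ : #Z ≤ 𝔠) :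
    ∃ σ : ℝ → Z, ∀ z a b, a < b → ¬ (Ioo a b ∩ σ ⁻¹' {z}).Countable := by
  let S : AddSubgroup ℝ := ((Rat.castHom ℝ : ℚ →+* ℝ) : ℚ →+ ℝ).range
  have hS : #S ≤ ℵ₀ := by
    have : Countable S := (countable_range ((Rat.castHom ℝ : ℚ →+* ℝ) : ℚ →+ ℝ)).to_subtype
    exact mk_le_aleph0
  have hquot : 𝔠 ≤ #(ℝ ⧸ S) := by
    by_contra! hlt
    have h1 : #ℝ = #(ℝ ⧸ S) * #S := by
      rw [← mk_congr (AddSubgroup.addGroupEquivQuotientProdAddSubgroup (s := S)).symm,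
        mk_prod, lift_id, lift_id]
    rw [mk_real] at h1
    have h2 : #(ℝ ⧸ S) * #S < 𝔠 :=
      mul_lt_of_lt aleph0_le_continuum hlt (hS.trans_lt aleph0_lt_continuum)
    exact h2.ne' h1
  have hle : #(Z × ℝ) ≤ #(ℝ ⧸ S) := by
    refine le_trans ?_ hquot
    rw [mk_prod, lift_id, lift_id, mk_real]
    exact mul_le_of_le aleph0_le_continuum hZ le_rfl
  obtain ⟨i⟩ := hle
  have : Nonempty (Z × ℝ) := inferInstance
  let σ : ℝ → Z := fun x => (Function.invFun i (QuotientAddGroup.mk x : ℝ ⧸ S)).1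
  refine ⟨σ, fun z a b hab hc => ?_⟩
  have hrep : ∀ e : ℝ, ∃ d ∈ Ioo a b, (QuotientAddGroup.mk d : ℝ ⧸ S) = i (z, e) := by
    intro e
    obtain ⟨x, hx⟩ := QuotientAddGroup.mk_surjective (i (z, e))
    obtain ⟨q, hq1, hq2⟩ := exists_rat_btwn (show a - x < b - x by linarith)
    refine ⟨x + q, ⟨by linarith, by linarith⟩, ?_⟩
    rw [← hx]
    refine (QuotientAddGroup.eq.2 ?_).symm
    exact show -x + (x + q) ∈ S from ⟨q, by simp⟩
  choose d hd hdi using hrep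
  have hinj : Function.Injective d := by
    intro e e' h
    have h2 := hdi e
    rw [h, hdi e'] at h2
    exact (congrArg Prod.snd (i.injective h2)).symm
  have hmaps : ∀ e, d e ∈ Ioo a b ∩ σ ⁻¹' {z} := by
    refine fun e => ⟨hd e, ?_⟩
    change (Function.invFun i (QuotientAddGroup.mk (d e) : ℝ ⧸ S)).1 = z
    rw [hdi, Function.leftInverse_invFun i.injective]
  have : (univ : Set ℝ).Countable :=
    (hc.preimage_of_injOn hinj.injOn).mono fun e _ => hmaps e
  exact not_countable_real this

/-- The Hilbert cube. -/
abbrev HilbertCube : Type := ℕ → unitInterval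

/-- The interval `[1,2]`, whose points label the children of a node; `0` is left free to mean
that there is no label. -/
abbrev Label : Type := Icc (1 : ℝ) 2

theorem not_countable_of_isOpen_label {Z' : Type*} {σ : ℝ → Z'} {z : Z'}
    (h : ∀ a b, a < b → ¬ (Ioo a b ∩ σ ⁻¹' {z}).Countable) {O : Set Label} (hO : IsOpen O)
    (hne : O.Nonempty) : ¬ {c : Label | c ∈ O ∧ σ c = z}.Countable := by
  obtain ⟨⟨c, hc1, hc2⟩, hc⟩ := hne
  obtain ⟨O', hO', rfl⟩ := isOpen_induced_iff.1 hO
  have hc' : c ∈ closure (Ioo (1 : ℝ) 2) := by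
    rw [closure_Ioo (by norm_num)]
    exact ⟨hc1, hc2⟩
  obtain ⟨x, hxO, hx⟩ := mem_closure_iff.1 hc' O' hO' hc
  obtain ⟨a, b, hab, hsub⟩ := mem_nhds_iff_exists_Ioo_subset.1
    ((hO'.inter isOpen_Ioo).mem_nhds ⟨hxO, hx⟩)
  intro hcount
  refine h a b (hab.1.trans hab.2) ((hcount.image Subtype.val).mono ?_)
  rintro y ⟨hy, hyz⟩
  have := hsub hy
  exact ⟨⟨y, this.2.1.le, this.2.2.le⟩, ⟨this.1, hyz⟩, rfl⟩

/-- A family of closed subsets of the Hilbert cube indexed by the nodes of a tree. A node is the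
list of the labels which lead to it, the last label first. The sets shrink along the tree, and
`NowhereFSet` passes to children. For every nonempty closed `L` inside the set at a node and every
continuous `φ`, many labels `c` lead to a child inside `L` on which `φ(·, c)` is constant; sets `L`
in `FSet` have to be excluded here at nodes with `NowhereFSet`. -/
structure Scheme where
  /-- The closed set at a node. -/
  K : List Label → Set HilbertCube
  isClosed : ∀ s, IsClosed (K s)
  nonempty : ∀ s, (K s).Nonempty
  root : K [] = univ
  child_subset : ∀ c s, K (c :: s) ⊆ K s
  child_nowhere : ∀ c s, NowhereFSet (K s) → NowhereFSet (K (c :: s))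
  not_countable : ∀ (s : List Label) (L : Set HilbertCube) (φ : C(HilbertCube × Label, ℝ))
    (O : Set Label), IsClosed L → L.Nonempty → L ⊆ K s → (NowhereFSet (K s) → ¬ FSet L) →
    IsOpen O → O.Nonempty → ¬ {c | c ∈ O ∧ K (c :: s) ⊆ L ∧ (∃ r, ∀ y ∈ K (c :: s), φ (y, c) = r) ∧
      (¬ FSet L → NowhereFSet (K (c :: s)))}.Countable

/-- The recursion step of a scheme: a requested set `L` and function `ψ` are taken into account only
if `L` lies in `K` and complying cannot destroy `NowhereFSet`. -/
theorem exists_child (K : Set HilbertCube) (hK : IsClosed K) (hne : K.Nonempty)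
    (L : Set HilbertCube) (ψ : C(HilbertCube, ℝ)) :
    ∃ K' ⊆ K, IsClosed K' ∧ K'.Nonempty ∧ (NowhereFSet K → NowhereFSet K') ∧
      (IsClosed L → L.Nonempty → L ⊆ K → (NowhereFSet K → ¬ FSet L) →
        K' ⊆ L ∧ (∃ r, ∀ y ∈ K', ψ y = r) ∧ (¬ FSet L → NowhereFSet K')) := by
  by_cases hL : IsClosed L ∧ L.Nonempty ∧ L ⊆ K ∧ (NowhereFSet K → ¬ FSet L)
  · obtain ⟨hL, hLne, hLK, hLF⟩ := hL
    obtain ⟨K', hK', hcl, hne', hr, hF⟩ := exists_subset_fibre hL hLne ψ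
    exact ⟨K', hK'.trans hLK, hcl, hne', fun h => hF (hLF h), fun _ _ _ _ => ⟨hK', hr, hF⟩⟩
  · exact ⟨K, subset_rfl, hK, hne, id, fun h1 h2 h3 h4 => (hL ⟨h1, h2, h3, h4⟩).elim⟩

theorem nonempty_scheme : Nonempty Scheme := by
  -- A label encodes a closed set, as the zero set of a function, and a function `φ`.
  obtain ⟨σ, hσ⟩ := exists_uncountable_fibres (C(HilbertCube, ℝ) × C(HilbertCube × Label, ℝ))
    (mk_le_continuum_of_completeSpace _)
  let slice : C(HilbertCube × Label, ℝ) → Label → C(HilbertCube, ℝ) :=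
    fun φ c => ⟨fun y => φ (y, c), by fun_prop⟩
  choose! child h using exists_child
  let T : List Label → Set HilbertCube := fun s => List.rec univ
    (fun (c : Label) _ K => child K ((σ c).1 ⁻¹' {0}) (slice (σ c).2 c)) s
  have hT : ∀ s, IsClosed (T s) ∧ (T s).Nonempty := by
    intro s
    induction s with
    | nil => exact ⟨isClosed_univ, univ_nonempty⟩
    | cons c s ih =>
      have := h (T s) ih.1 ih.2 ((σ c).1 ⁻¹' {0}) (slice (σ c).2 c)
      exact ⟨this.2.1, this.2.2.1⟩
  have hchild := fun (c : Label) s =>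
    h (T s) (hT s).1 (hT s).2 ((σ c).1 ⁻¹' {0}) (slice (σ c).2 c)
  refine ⟨T, fun s => (hT s).1, fun s => (hT s).2, rfl, fun c s => (hchild c s).1,
    fun c s => (hchild c s).2.2.2.1, ?_⟩
  intro s L φ O hL hLne hLK hLF hO hOne
  obtain ⟨χ, hχ⟩ : ∃ χ : C(HilbertCube, ℝ), χ ⁻¹' {0} = L := by
    let _ := TopologicalSpace.metrizableSpaceMetric HilbertCube
    refine ⟨⟨fun x => Metric.infDist x L, Metric.continuous_infDist_pt L⟩, ?_⟩
    ext x
    exact (hL.mem_iff_infDist_zero hLne).symm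
  refine fun hc => not_countable_of_isOpen_label (hσ (χ, φ)) hO hOne (hc.mono ?_)
  rintro c ⟨hcO, hc⟩
  have h1 := (hchild c s).2.2.2.2
  rw [hc, hχ] at h1
  obtain ⟨h2, h3, h4⟩ := h1 hL hLne hLK hLF
  have h5 : T (c :: s) = child (T s) L (slice φ c) := by
    rw [← hχ]
    change child (T s) ((σ c).1 ⁻¹' {0}) (slice (σ c).2 c) = _
    rw [hc]
  refine ⟨hcO, ?_⟩
  rw [h5]
  exact ⟨h2, h3, h4⟩

/-! ### Branches -/

/-- A nonempty finite or infinite sequence `c₁, c₂, …` of labels, encoded as the function on nodes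
taking the value `cₙ₊₁` at the node `[cₙ, …, c₁]` for every `n` and the value `0` at all nodes which
do not have this form. -/
structure IsBranch (F : List Label → ℝ) : Prop where
  value : ∀ s, F s = 0 ∨ F s ∈ Icc (1 : ℝ) 2
  root : F [] ≠ 0
  parent : ∀ (c : Label) s, F (c :: s) ≠ 0 → F s = c

theorem Label.ne_zero (c : Label) : (c : ℝ) ≠ 0 := by
  have := c.2.1
  intro h
  linarith

namespace IsBranch

variable {F : List Label → ℝ}

theorem exists_label (h : IsBranch F) {s : List Label} (hs : F s ≠ 0) : ∃ c : Label, F s = c :=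
  ⟨⟨F s, (h.value s).resolve_left hs⟩, rfl⟩

theorem ne_zero_iff (h : IsBranch F) (s : List Label) : F s ≠ 0 ↔ 1 / 2 < F s := by
  constructor
  · intro hs
    have := ((h.value s).resolve_left hs).1
    linarith
  · intro hs h0
    rw [h0] at hs
    linarith

theorem parent_ne_zero (h : IsBranch F) {c : Label} {s : List Label} (hs : F (c :: s) ≠ 0) :
    F s ≠ 0 := by
  rw [h.parent c s hs]
  exact c.ne_zero

end IsBranch

/-- The nodes reached along the branch `F`. If the branch ends, its end node, at which `F` vanishes,
is included. -/
def reached (F : List Label → ℝ) : Set (List Label) :=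
  {t | t = [] ∨ ∃ (c : Label) (s : List Label), t = c :: s ∧ F s = c}

theorem IsBranch.mem_reached {F : List Label → ℝ} (h : IsBranch F) {s : List Label}
    (hs : F s ≠ 0) : s ∈ reached F := by
  cases s with
  | nil => exact .inl rfl
  | cons c s => exact .inr ⟨c, s, rfl, h.parent c s hs⟩

theorem IsBranch.injOn_length {F : List Label → ℝ} (h : IsBranch F) :
    InjOn List.length (reached F) := by
  intro s
  induction s with
  | nil => exact fun _ t _ hst => (List.length_eq_zero_iff.1 hst.symm).symm
  | cons c s ih =>
    rintro hs (_ | ⟨d, t⟩) ht hst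
    · simp at hst
    · obtain ⟨c', s', hcs, hc⟩ := hs.resolve_left (by simp)
      obtain ⟨d', t', hdt, hd⟩ := ht.resolve_left (by simp)
      obtain ⟨rfl, rfl⟩ := List.cons_eq_cons.1 hcs
      obtain ⟨rfl, rfl⟩ := List.cons_eq_cons.1 hdt
      have hst' : s = t := by
        refine ih (h.mem_reached ?_) (h.mem_reached ?_) (by simpa using hst)
        · rw [hc]
          exact c.ne_zero
        · rw [hd]
          exact d.ne_zero
      subst hst'
      rw [Subtype.ext (hc.symm.trans hd)]

theorem IsBranch.countable_reached {F : List Label → ℝ} (h : IsBranch F) : (reached F).Countable :=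
  countable_of_injective_of_countable_image h.injOn_length (to_countable _)

/-- A branch is determined by its values at the nodes it reaches. -/
theorem IsBranch.eq_of_eqOn_reached {F F' : List Label → ℝ} (h : IsBranch F) (h' : IsBranch F')
    (heq : EqOn F F' (reached F)) : F = F' := by
  funext t
  induction t with
  | nil => exact heq (.inl rfl)
  | cons c s ih =>
    by_cases hc : F s = c
    · exact heq (.inr ⟨c, s, rfl, hc⟩)
    · have h1 : F (c :: s) = 0 := by
        by_contra h0
        exact hc (h.parent c s h0)
      have h2 : F' (c :: s) = 0 := by
        by_contra h0
        exact hc (ih.trans (h'.parent c s h0))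
      rw [h1, h2]

/-- The finite branch with the given labels. -/
noncomputable def chain : List Label → List Label → ℝ
  | [] => 0
  | c :: s => Function.update (chain s) s (c : ℝ)

theorem chain_cons_self (c : Label) (s : List Label) : chain (c :: s) s = c := by
  simp [chain]

theorem chain_cons_of_ne (c : Label) {s t : List Label} (h : t ≠ s) :
    chain (c :: s) t = chain s t := by
  simp [chain, h]

theorem chain_eq_zero {s t : List Label} (h : s.length ≤ t.length) : chain s t = 0 := by
  induction s with
  | nil => rfl
  | cons c s ih =>
    rw [List.length_cons] at h
    rw [chain_cons_of_ne _ (by rintro rfl; omega), ih (by omega)]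

theorem isBranch_chain (c : Label) (s : List Label) : IsBranch (chain (c :: s)) := by
  induction s generalizing c with
  | nil =>
    refine ⟨fun t => ?_, by simpa [chain_cons_self] using c.ne_zero, fun d t ht => ?_⟩
    · by_cases h : t = []
      · subst h
        exact .inr (by rw [chain_cons_self]; exact c.2)
      · exact .inl (by rw [chain_cons_of_ne _ h]; rfl)
    · exact (ht (by rw [chain_cons_of_ne _ (by simp)]; rfl)).elim
  | cons d s ih =>
    refine ⟨fun t => ?_, ?_, fun e t ht => ?_⟩
    · by_cases h : t = d :: s
      · subst h
        exact .inr (by rw [chain_cons_self]; exact c.2)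
      · rw [chain_cons_of_ne _ h]
        exact (ih d).value t
    · rw [chain_cons_of_ne _ (by simp)]
      exact (ih d).root
    · by_cases h : e :: t = d :: s
      · obtain ⟨rfl, rfl⟩ := List.cons_eq_cons.1 h
        rw [chain_cons_of_ne _ (by simp), chain_cons_self]
      · rw [chain_cons_of_ne _ h] at ht
        have h1 := (ih d).parent e t ht
        rw [chain_cons_of_ne _ ?_, h1]
        rintro rfl
        exact ht (chain_eq_zero (by simp))

/-- A finite branch whose last label is the value of `F` at its last node follows `F`. -/
theorem IsBranch.chain_eq {F : List Label → ℝ} (h : IsBranch F) {c : Label} {s : List Label}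
    (hs : F s = c) {t : List Label} (ht : chain (c :: s) t ≠ 0) : chain (c :: s) t = F t := by
  induction s generalizing c with
  | nil =>
    by_cases h0 : t = []
    · subst h0
      rw [chain_cons_self, hs]
    · exact (ht (by rw [chain_cons_of_ne _ h0]; rfl)).elim
  | cons d s ih =>
    by_cases h0 : t = d :: s
    · subst h0
      rw [chain_cons_self, hs]
    · rw [chain_cons_of_ne _ h0] at ht ⊢
      refine ih (h.parent d s ?_) ht
      rw [hs]
      exact c.ne_zero

/-- Away from its end node, a finite branch goes on as long as its labels do. -/
theorem chain_cons_ne_zero {c d : Label} {s t : List Label} (h : chain (c :: s) t = d)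
    (hne : d :: t ≠ c :: s) : chain (c :: s) (d :: t) ≠ 0 := by
  induction s generalizing c with
  | nil =>
    by_cases h0 : t = []
    · subst h0
      rw [chain_cons_self] at h
      exact (hne (by rw [Subtype.ext h])).elim
    · rw [chain_cons_of_ne _ h0] at h
      exact (d.ne_zero h.symm).elim
  | cons e s ih =>
    by_cases h0 : t = e :: s
    · subst h0
      rw [chain_cons_self] at h
      exact (hne (by rw [Subtype.ext h])).elim
    · rw [chain_cons_of_ne _ h0] at h
      by_cases h1 : d :: t = e :: s
      · rw [h1, chain_cons_self]
        exact c.ne_zero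
      · rw [chain_cons_of_ne _ h1]
        exact ih h h1

theorem IsBranch.chain_cons_eq {F : List Label → ℝ} (h : IsBranch F) {c : Label} {s : List Label}
    (hs : F s = c) {t : List Label} {d : Label} (ht : chain (c :: s) t = F t)
    (hne : d :: t ≠ c :: s) : chain (c :: s) (d :: t) = F (d :: t) := by
  by_cases h0 : chain (c :: s) (d :: t) = 0
  · by_contra h1
    have h2 : F (d :: t) ≠ 0 := fun h3 => h1 (h0.trans h3.symm)
    exact chain_cons_ne_zero (ht.trans (h.parent d t h2)) hne h0
  · exact h.chain_eq hs h0

/-- A finite branch which follows `F` and is not continued by `F` is all of `F`. -/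
theorem IsBranch.eq_chain {F : List Label → ℝ} (h : IsBranch F) {c : Label} {s : List Label}
    (hs : F s = c) (h0 : F (c :: s) = 0) : F = chain (c :: s) := by
  funext t
  induction t with
  | nil => exact (h.chain_eq hs (isBranch_chain c s).root).symm
  | cons d t ih =>
    by_cases hne : d :: t = c :: s
    · rw [hne, h0, chain_eq_zero le_rfl]
    · exact (h.chain_cons_eq hs ih.symm hne).symm

/-- Finite branches are dense. -/
theorem IsBranch.exists_chain {F : List Label → ℝ} (h : IsBranch F) (n : ℕ) :
    ∃ (c : Label) (s : List Label), F s = c ∧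
      ∀ t : List Label, t.length ≤ n → chain (c :: s) t = F t := by
  induction n with
  | zero =>
    obtain ⟨c, hc⟩ := h.exists_label h.root
    refine ⟨c, [], hc, fun t ht => ?_⟩
    rw [List.length_eq_zero_iff.1 (Nat.le_zero.1 ht), chain_cons_self, hc]
  | succ n ih =>
    obtain ⟨c, s, hs, hn⟩ := ih
    by_cases h0 : F (c :: s) = 0
    · refine ⟨c, s, hs, fun t _ => ?_⟩
      rw [← h.eq_chain hs h0]
    · obtain ⟨d, hd⟩ := h.exists_label h0
      refine ⟨d, c :: s, hd, fun t ht => ?_⟩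
      by_cases ht' : t = c :: s
      · rw [ht', chain_cons_self, hd]
      rw [chain_cons_of_ne _ ht']
      cases t with
      | nil => exact hn [] (Nat.zero_le _)
      | cons e t => exact h.chain_cons_eq hs (hn t (by simpa using ht)) ht'

/-! ### The compact space of a scheme -/

/-- The points of the space are pairs of a point `x` of the Hilbert cube and a branch all of whose
nodes have `x` in their closed set. The topology is that of a product, so near the end of a finite
branch with last label `c` at the node `s` there are the branches through `s` whose label at `s` is
close, but not equal, to `c`. -/
def Scheme.space (T : Scheme) : Set (HilbertCube × (List Label → ℝ)) :=
  {p | IsBranch p.2 ∧ ∀ s, p.2 s ≠ 0 → p.1 ∈ T.K s}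

namespace Scheme

variable (T : Scheme)

theorem isCompact_space : IsCompact T.space := by
  have hcpt : IsCompact ((univ : Set HilbertCube) ×ˢ
      (pi univ fun _ : List Label => ({0} ∪ Icc (1 : ℝ) 2))) :=
    isCompact_univ.prod (isCompact_univ_pi fun _ => isCompact_singleton.union isCompact_Icc)
  have heq : T.space = {p | (∀ s, p.2 s ∈ {0} ∪ Icc (1 : ℝ) 2) ∧ p.2 [] ∈ Icc (1 : ℝ) 2 ∧
      (∀ (c : Label) s, p.2 (c :: s) = 0 ∨ p.2 s = (c : ℝ)) ∧ ∀ s, p.2 s = 0 ∨ p.1 ∈ T.K s} := by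
    ext p
    constructor
    · rintro ⟨h, hK⟩
      exact ⟨h.value, (h.value _).resolve_left h.root,
        fun c s => or_iff_not_imp_left.2 (h.parent c s), fun s => or_iff_not_imp_left.2 (hK s)⟩
    · rintro ⟨h1, h2, h3, h4⟩
      refine ⟨⟨h1, fun h0 => ?_, fun c s => or_iff_not_imp_left.1 (h3 c s)⟩,
        fun s => or_iff_not_imp_left.1 (h4 s)⟩
      have := h2.1
      linarith
  refine hcpt.of_isClosed_subset ?_
    fun p (hp : p ∈ T.space) => ⟨mem_univ _, fun s _ => hp.1.value s⟩
  have hev : ∀ s, Continuous fun p : HilbertCube × (List Label → ℝ) => p.2 s := fun s => by fun_prop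
  rw [heq]
  simp only [ofPred_and, ofPred_forall, ofPred_or]
  refine .inter ?_ (.inter ?_ (.inter ?_ ?_))
  · exact isClosed_iInter fun s => (isClosed_singleton.union isClosed_Icc).preimage (hev s)
  · exact isClosed_Icc.preimage (hev [])
  · exact isClosed_iInter fun c => isClosed_iInter fun s =>
      (isClosed_eq (hev _) continuous_const).union (isClosed_eq (hev _) continuous_const)
  · exact isClosed_iInter fun s => (isClosed_eq (hev _) continuous_const).union
      ((T.isClosed s).preimage continuous_fst)

instance : CompactSpace T.space := isCompact_iff_compactSpace.1 T.isCompact_space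

variable {T}

theorem continuous_eval (s : List Label) : Continuous fun p : T.space => p.1.2 s := by fun_prop

theorem continuous_point : Continuous fun p : T.space => p.1.1 := by fun_prop

/-- The finite branch with last label `c` at the node `s`, over the point `x`. -/
noncomputable def pt (s : List Label) (c : Label) (x : HilbertCube) (hx : x ∈ T.K s) : T.space :=
  ⟨(x, chain (c :: s)), isBranch_chain c s, by
    intro t ht
    change chain (c :: s) t ≠ 0 at ht
    change x ∈ T.K t
    induction s generalizing c with
    | nil =>
      by_cases h : t = []
      · rwa [h]
      · exact (ht (by rw [chain_cons_of_ne _ h]; rfl)).elim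
    | cons d s ih =>
      by_cases h : t = d :: s
      · rwa [h]
      · exact ih d (T.child_subset d s hx) (by rwa [chain_cons_of_ne _ h] at ht)⟩

theorem continuous_pt (s : List Label) :
    Continuous fun q : T.K s × Label => (pt s q.2 q.1 q.1.2 : T.space) := by
  refine Continuous.subtype_mk (.prodMk (by fun_prop) (continuous_pi fun t => ?_)) _
  by_cases h : t = s
  · subst h
    simp only [chain_cons_self]
    fun_prop
  · simp only [chain_cons_of_ne _ h]
    fun_prop

/-- The points whose branch goes through the node `s`. -/
def cone (T : Scheme) (s : List Label) : Set T.space := {p | p.1.2 s ≠ 0}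

theorem isClopen_cone (s : List Label) : IsClopen (T.cone s) := by
  constructor
  · have : T.cone s = {p | (1 : ℝ) ≤ p.1.2 s} := by
      ext p
      refine ⟨fun h => ((p.2.1.value s).resolve_left h).1, fun h h0 => ?_⟩
      have h : (1 : ℝ) ≤ p.1.2 s := h
      rw [h0] at h
      linarith
    rw [this]
    exact isClosed_le continuous_const (continuous_eval s)
  · have : T.cone s = {p | (1 : ℝ) / 2 < p.1.2 s} := by
      ext p
      exact p.2.1.ne_zero_iff s
    rw [this]
    exact isOpen_lt continuous_const (continuous_eval s)

/-- Finite branches are dense, even over a fixed point of the Hilbert cube. -/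
theorem exists_pt_mem {W : Set T.space} (hW : IsOpen W) {p : T.space} (hp : p ∈ W) :
    ∃ (s : List Label) (c : Label) (hx : p.1.1 ∈ T.K s), pt s c p.1.1 hx ∈ W := by
  choose c s hs h using p.2.1.exists_chain
  have hK : ∀ n, p.1.1 ∈ T.K (s n) := fun n => p.2.2 _ (by rw [hs]; exact (c n).ne_zero)
  have htend : Tendsto (fun n => (pt (s n) (c n) p.1.1 (hK n) : T.space)) atTop (𝓝 p) := by
    rw [tendsto_subtype_rng, Prod.tendsto_iff]
    refine ⟨tendsto_const_nhds, tendsto_pi_nhds.2 fun t => ?_⟩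
    refine tendsto_const_nhds.congr' ?_
    filter_upwards [eventually_ge_atTop t.length] with n hn
    exact (h n t hn).symm
  obtain ⟨m, hm⟩ := (htend.eventually (hW.mem_nhds hp)).exists
  exact ⟨s m, c m, hK m, hm⟩

/-- A closed set which contains no branch ending right after the node `s` meets the cones of only
finitely many children of `s`, because these cones are disjoint open sets which cover its
intersection with the cone of `s`. -/
theorem finite_children {B : Set T.space} (hB : IsClosed B) (s : List Label)
    (h : ∀ c x (hx : x ∈ T.K s), pt s c x hx ∉ B) :
    {c : Label | (T.cone (c :: s) ∩ B).Nonempty}.Finite := by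
  have hc : IsCompact (T.cone s ∩ B) := ((isClopen_cone s).1.inter hB).isCompact
  obtain ⟨J, hJ⟩ := hc.elim_finite_subcover (fun c : Label => T.cone (c :: s))
    (fun c => (isClopen_cone _).2) (by
      rintro p ⟨hps, hpB⟩
      obtain ⟨c, hc⟩ := p.2.1.exists_label hps
      refine mem_iUnion.2 ⟨c, fun h0 => h c p.1.1 (p.2.2 s hps) ?_⟩
      convert hpB using 1
      exact Subtype.ext (Prod.ext rfl (p.2.1.eq_chain hc h0).symm))
  refine J.finite_toSet.subset ?_
  rintro c ⟨p, hpc, hpB⟩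
  obtain ⟨d, hd, hpd⟩ := mem_iUnion₂.1 (hJ ⟨p.2.1.parent_ne_zero hpc, hpB⟩)
  have : c = d := Subtype.ext ((p.2.1.parent c s hpc).symm.trans (p.2.1.parent d s hpd))
  rwa [this]

/-! ### Continuous functions on the space -/

/-- Every continuous real function on the space of a scheme is constant on an open subset of any
given nonempty open set. At a node, all but countably many labels `c` lead to children on whose cone
`g` depends only on `x`, in the way in which it does over the label `c` at the node itself; some of
these children were chosen within a fibre of that function. -/
theorem E0_real_eq_univ : E0 T.space ℝ = univ := by
  refine eq_univ_of_forall fun g => dense_iff_inter_open.2 fun W hW ⟨p, hp⟩ => ?_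
  obtain ⟨s, c, hx, hpt⟩ := exists_pt_mem hW hp
  generalize p.1.1 = x at hx hpt
  -- A closed box around the finite branch whose part over the node `s` is contained in `W`.
  have hnhds : {q : T.K s × Label | pt s q.2 q.1 q.1.2 ∈ W} ∈ 𝓝 ((⟨x, hx⟩, c) : T.K s × Label) :=
    (hW.preimage (continuous_pt s)).mem_nhds hpt
  rw [nhds_prod_eq, mem_prod_iff] at hnhds
  obtain ⟨U, hU, D, hD, hUD⟩ := hnhds
  rw [nhds_subtype_eq_comap, mem_comap] at hU
  obtain ⟨U', hU', hUU'⟩ := hU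
  obtain ⟨V, hV, hVc, hVU⟩ := exists_mem_nhds_isClosed_subset hU'
  obtain ⟨E, hE, hEc, hED⟩ := exists_mem_nhds_isClosed_subset hD
  -- `φ` extends the function that `g` induces over the node `s`.
  obtain ⟨φ, hφ⟩ : ∃ φ : C(HilbertCube × Label, ℝ),
      ∀ c x (hx : x ∈ T.K s), φ (x, c) = g (pt s c x hx) := by
    let e : T.K s × Label → HilbertCube × Label := Prod.map Subtype.val id
    have he : IsClosedEmbedding e := (T.isClosed s).isClosedEmbedding_subtypeVal.prodMap .id
    obtain ⟨φ, hφ⟩ := ContinuousMap.exists_extension' he (g.comp ⟨_, continuous_pt s⟩)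
    exact ⟨φ, fun c x hx => congrFun hφ (⟨x, hx⟩, c)⟩
  let lab : T.space → Label := fun q => projIcc 1 2 one_le_two (q.1.2 s)
  have hlab : ∀ (q : T.space) (d : Label), q.1.2 s = d → lab q = d := by
    intro q d hd
    change projIcc 1 2 one_le_two (q.1.2 s) = d
    rw [hd, projIcc_val]
  have hlabc : Continuous lab := continuous_projIcc.comp (continuous_eval s)
  have hptlab : ∀ d y (hy : y ∈ T.K s), lab (pt s d y hy) = d := fun d y hy =>
    hlab _ d (chain_cons_self d s)
  -- The labels for which a child leaves `W` over the box.
  have hbad1 : {d : Label | (T.cone (d :: s) ∩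
      ({q | q.1.1 ∈ V ∧ lab q ∈ E} \ W)).Nonempty}.Countable := by
    refine (finite_children ?_ s ?_).countable
    · exact ((hVc.preimage continuous_point).inter (hEc.preimage hlabc)).sdiff hW
    · rintro d y hy ⟨⟨hyV, hdE⟩, hnW⟩
      rw [hptlab] at hdE
      exact hnW (hUD (show ((⟨y, hy⟩, d) : T.K s × Label) ∈ U ×ˢ D from
        ⟨hUU' (hVU hyV), hED hdE⟩))
  -- The labels for which `g` is not given by `φ` on the cone of the child.
  have hbad2 : {d : Label | (T.cone (d :: s) ∩
      {q | g q ≠ φ (q.1.1, lab q)}).Nonempty}.Countable := by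
    have : {d : Label | (T.cone (d :: s) ∩ {q | g q ≠ φ (q.1.1, lab q)}).Nonempty} ⊆
        ⋃ n : ℕ, {d : Label | (T.cone (d :: s) ∩
          {q | 1 / ((n : ℝ) + 1) ≤ |g q - φ (q.1.1, lab q)|}).Nonempty} := by
      rintro d ⟨q, hqd, hq⟩
      obtain ⟨n, hn⟩ := exists_nat_one_div_lt (abs_pos.2 (sub_ne_zero.2 hq))
      exact mem_iUnion.2 ⟨n, q, hqd, hn.le⟩
    refine (countable_iUnion fun n => (finite_children ?_ s ?_).countable).mono this
    · refine isClosed_le continuous_const (g.continuous.sub (φ.continuous.comp ?_)).abs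
      exact continuous_point.prodMk hlabc
    · intro d y hy h0
      have h0 : 1 / ((n : ℝ) + 1) ≤ |g (pt s d y hy) - φ (y, lab (pt s d y hy))| := h0
      rw [hptlab, hφ d y hy, sub_self, abs_zero] at h0
      exact absurd h0 (not_le.2 Nat.one_div_pos_of_nat)
  have hgood := T.not_countable s (T.K s ∩ V) φ (interior E) ((T.isClosed s).inter hVc)
    ⟨x, hx, mem_of_mem_nhds hV⟩ inter_subset_left (fun h => h.not_fSet x hx V hV hVc)
    isOpen_interior ⟨c, mem_interior_iff_mem_nhds.2 hE⟩
  obtain ⟨d, ⟨hdE, hdV, ⟨r, hr⟩, -⟩, hd⟩ := not_subset.1 fun hsub =>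
    hgood ((hbad1.union hbad2).mono hsub)
  rw [mem_union, not_or] at hd
  have hcone : ∀ q ∈ T.cone (d :: s), q ∈ W ∧ g q = r := by
    intro q hq
    have hqd : lab q = d := hlab q d (q.2.1.parent d s hq)
    have hqK : q.1.1 ∈ T.K (d :: s) := q.2.2 _ hq
    constructor
    · by_contra hqW
      refine hd.1 ⟨q, hq, ⟨(hdV hqK).2, ?_⟩, hqW⟩
      rw [hqd]
      exact interior_subset hdE
    · by_contra hqr
      refine hd.2 ⟨q, hq, fun h => hqr ?_⟩
      rw [h, hqd, hr _ hqK]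
  obtain ⟨y, hy⟩ := T.nonempty (d :: s)
  have hmem : (pt (d :: s) d y hy : T.space) ∈ T.cone (d :: s) := by
    change chain (d :: d :: s) (d :: s) ≠ 0
    rw [chain_cons_self]
    exact d.ne_zero
  exact ⟨_, (hcone _ hmem).1, subset_locConstSet (isClopen_cone (d :: s)).2
    (fun a ha b hb => ((hcone a ha).2).trans ((hcone b hb).2).symm) hmem⟩

theorem nowhereFSet_of_chain {s : List Label} {c d : Label} (h : NowhereFSet (T.K [d]))
    (hs : chain (c :: s) [d] ≠ 0) : NowhereFSet (T.K s) := by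
  induction s generalizing c with
  | nil => exact (hs (by rw [chain_cons_of_ne _ (by simp)]; rfl)).elim
  | cons e s ih =>
    by_cases h0 : [d] = e :: s
    · rwa [← h0]
    · rw [chain_cons_of_ne _ h0] at hs
      exact T.child_nowhere e s (ih hs)

/-- A compact metrizable space outside `𝓕` is the target of a continuous map which is nowhere
locally constant on the cone of a suitable child of the root. -/
theorem E0_ne_univ {M : Type v} [TopologicalSpace M] [TopologicalSpace.MetrizableSpace M]
    [CompactSpace M] (hM : ¬ MemF M) : E0 T.space M ≠ univ := by
  obtain ⟨e, he⟩ : ∃ e : M → HilbertCube, IsClosedEmbedding e := by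
    let _ := TopologicalSpace.metrizableSpaceMetric M
    obtain ⟨e, he⟩ := Metric.PiNatEmbed.exists_embedding_to_hilbert_cube (X := M)
    exact ⟨e, he.continuous.isClosedEmbedding he.injective⟩
  have hF : ¬ FSet (range e) := fun h =>
    hM (h.memF M e he.continuous he.injective mem_range_self)
  have hne : (range e).Nonempty := by
    by_contra h
    rw [not_nonempty_iff_eq_empty] at h
    exact hF (h ▸ .subsingleton _ subsingleton_empty)
  have h1 := T.not_countable [] (range e) 0 univ he.isClosed_range hne
    (by rw [T.root]; exact subset_univ _) (fun _ => hF) isOpen_univ ⟨⟨1, by norm_num⟩, mem_univ _⟩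
  obtain ⟨d, ⟨-, hde, -, hdF⟩, -⟩ := not_subset.1 fun hsub => h1 (countable_empty.mono hsub)
  have hN := hdF hF
  obtain ⟨-, m₀, -⟩ := hne
  classical
  let ρ : T.space → HilbertCube := (T.cone [d]).piecewise (fun q => q.1.1) fun _ => e m₀
  have hρ : Continuous ρ :=
    continuous_point.piecewise (by simp [(isClopen_cone [d]).frontier_eq]) continuous_const
  have hρe : ∀ q, ∃ m, e m = ρ q := by
    intro q
    by_cases hq : q ∈ T.cone [d]
    · simp only [ρ, piecewise_eq_of_mem _ _ _ hq]
      exact hde (q.2.2 _ hq)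
    · simp only [ρ, piecewise_eq_of_notMem _ _ _ hq]
      exact ⟨m₀, rfl⟩
  choose f hf using hρe
  have hfc : Continuous f := he.isEmbedding.continuous_iff.2 (by
    convert hρ using 1
    exact funext hf)
  intro hall
  have hdense : Dense (locConstSet f) := by
    have : (⟨f, hfc⟩ : C(T.space, M)) ∈ E0 T.space M := hall ▸ mem_univ _
    exact this
  obtain ⟨y₀, hy₀⟩ := T.nonempty [d]
  have hcone : (T.cone [d]).Nonempty := by
    refine ⟨pt [d] d y₀ hy₀, ?_⟩
    change chain [d, d] [d] ≠ 0
    rw [chain_cons_self]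
    exact d.ne_zero
  obtain ⟨p, hpd, V, ⟨hV, hVf⟩, hpV⟩ := hdense.inter_open_nonempty _ (isClopen_cone [d]).2 hcone
  obtain ⟨s, c, hx, hpt⟩ := exists_pt_mem (hV.inter (isClopen_cone [d]).2) ⟨hpV, hpd⟩
  have hNs : NowhereFSet (T.K s) := nowhereFSet_of_chain hN hpt.2
  generalize p.1.1 = x at hx hpt
  have hcont : Continuous fun y : T.K s => (pt s c y.1 y.2 : T.space) :=
    (continuous_pt s).comp (.prodMk continuous_id continuous_const)
  have hnhds := ((hV.inter (isClopen_cone [d]).2).preimage hcont).mem_nhds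
    (show (⟨x, hx⟩ : T.K s) ∈ _ from hpt)
  rw [nhds_subtype_eq_comap, mem_comap] at hnhds
  obtain ⟨O, hO, hOsub⟩ := hnhds
  obtain ⟨A, hA, hAc, hAO⟩ := exists_mem_nhds_isClosed_subset hO
  refine hNs.not_fSet x hx A hA hAc (.subsingleton _ ?_)
  rintro y ⟨hy, hyA⟩ z ⟨hz, hzA⟩
  have hy' := hOsub (show (⟨y, hy⟩ : T.K s) ∈ _ from hAO hyA)
  have hz' := hOsub (show (⟨z, hz⟩ : T.K s) ∈ _ from hAO hzA)
  have hfe : ∀ (w : HilbertCube) (hw : w ∈ T.K s), (pt s c w hw : T.space) ∈ T.cone [d] →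
      e (f (pt s c w hw)) = w := by
    intro w hw hwd
    rw [hf]
    exact piecewise_eq_of_mem _ _ _ hwd
  rw [← hfe y hy hy'.2, ← hfe z hz hz'.2, hVf _ hy'.1 _ hz'.1]

end Scheme

/-! ### Uniform Eberlein compacta and first countability -/

/-- A function into `ℓ²` with bounded range is weakly continuous if its coordinates are continuous:
the pairing with a vector is the uniform limit of the pairings with its finite parts. -/
theorem continuous_toWeakSpace {X ι : Type*} [TopologicalSpace X]
    (Φ : X → lp (fun _ : ι => ℝ) 2) (B : ℝ) (hB : ∀ p, ‖Φ p‖ ≤ B)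
    (hΦ : ∀ i, Continuous fun p => Φ p i) : Continuous fun p => toWeakSpace ℝ _ (Φ p) := by
  classical
  refine WeakBilin.continuous_of_continuous_eval _ fun L => ?_
  change Continuous fun p => L (Φ p)
  obtain ⟨y, rfl⟩ := (InnerProductSpace.toDual ℝ (lp (fun _ : ι => ℝ) 2)).surjective L
  simp only [InnerProductSpace.toDual_apply_apply]
  refine continuous_of_uniform_approx_of_continuous fun u hu => ?_
  obtain ⟨ε, hε, hεu⟩ := Metric.mem_uniformity_dist.1 hu
  have hy := lp.hasSum_single (p := 2) (by norm_num) y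
  obtain ⟨J, hJ⟩ := (Metric.tendsto_nhds.1 hy (ε / (|B| + 1)) (by positivity)).exists
  refine ⟨fun p => inner ℝ (∑ i ∈ J, lp.single 2 i (y i)) (Φ p), ?_, fun p => hεu ?_⟩
  · simp only [sum_inner, lp.inner_single_left]
    exact continuous_finsetSum _ fun i _ => continuous_const.inner (hΦ i)
  · rw [Real.dist_eq, ← inner_sub_left]
    rw [dist_eq_norm, norm_sub_rev] at hJ
    calc _ ≤ ‖y - ∑ i ∈ J, lp.single 2 i (y i)‖ * ‖Φ p‖ := abs_real_inner_le_norm _ _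
      _ ≤ ‖y - ∑ i ∈ J, lp.single 2 i (y i)‖ * (|B| + 1) := by
        gcongr
        exact (hB p).trans ((le_abs_self B).trans (by linarith))
      _ < ε := by rwa [lt_div_iff₀ (by positivity)] at hJ

/-- A compact space is uniform Eberlein if its points are separated by a family of continuous real
functions whose squares have uniformly bounded sums. -/
theorem IsUniformEberleinCompact.of_separating {X ι : Type u} [TopologicalSpace X] [CompactSpace X]
    (f : ι → X → ℝ) (hf : ∀ i, Continuous (f i)) (hsep : ∀ p q, (∀ i, f i p = f i q) → p = q)
    (B : ℝ) (hB : ∀ p (J : Finset ι), ∑ i ∈ J, f i p ^ 2 ≤ B) : IsUniformEberleinCompact X := by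
  have hmem : ∀ p, Memℓp (fun i => f i p) 2 := fun p =>
    memℓp_gen' (C := B) fun J => by simpa using hB p J
  let Φ : X → lp (fun _ : ι => ℝ) 2 := fun p => ⟨fun i => f i p, hmem p⟩
  have hbound : ∀ p, ‖Φ p‖ ≤ √B := by
    intro p
    refine lp.norm_le_of_forall_sum_le (by norm_num) (Real.sqrt_nonneg _) fun J => ?_
    have h0 : 0 ≤ B := by simpa using hB p ∅
    simpa [Real.sq_sqrt h0, Φ] using hB p J
  have hcont : Continuous fun p => toWeakSpace ℝ _ (Φ p) :=
    continuous_toWeakSpace Φ _ hbound hf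
  have hinj : Function.Injective fun p => toWeakSpace ℝ _ (Φ p) := by
    intro p q h
    have h := (toWeakSpace ℝ _).injective h
    exact hsep p q fun i => congrFun (congrArg Subtype.val h) i
  refine ⟨lp (fun _ : ι => ℝ) 2, inferInstance, inferInstance, inferInstance,
    range fun p => toWeakSpace ℝ _ (Φ p), isCompact_range hcont, ⟨?_⟩⟩
  exact (hcont.isClosedEmbedding hinj).isEmbedding.toHomeomorph

/-- In a compact space, a fibre consisting of a single point inherits a countable neighbourhood
basis from the range. -/
theorem isCountablyGenerated_nhds_of_fibre {X Z : Type*} [TopologicalSpace X] [CompactSpace X]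
    [TopologicalSpace Z] [T2Space Z] [FirstCountableTopology Z] {Ψ : X → Z} (hΨ : Continuous Ψ)
    {p : X} (hp : ∀ q, Ψ q = Ψ p → q = p) : (𝓝 p).IsCountablyGenerated := by
  have : 𝓝 p = comap Ψ (𝓝 (Ψ p)) := by
    refine le_antisymm hΨ.continuousAt.le_comap fun U hU => ?_
    have hcl := (isOpen_interior (s := U)).isClosed_compl.isCompact.image hΨ |>.isClosed
    refine mem_comap.2 ⟨_, hcl.isOpen_compl.mem_nhds ?_, fun q hq => ?_⟩
    · rintro ⟨q, hq, hqp⟩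
      rw [hp q hqp] at hq
      exact hq (mem_interior_iff_mem_nhds.2 hU)
    · by_contra hqU
      exact hq ⟨q, fun h => hqU (interior_subset h), rfl⟩
  rw [this]
  infer_instance

namespace Scheme

variable (T : Scheme)

instance firstCountableTopology_space : FirstCountableTopology T.space := by
  refine ⟨fun p => ?_⟩
  have : Countable (reached p.1.2) := p.2.1.countable_reached.to_subtype
  refine isCountablyGenerated_nhds_of_fibre
    (Ψ := fun q : T.space => (q.1.1, fun s : reached p.1.2 => q.1.2 s)) (by fun_prop) ?_
  intro q hq
  obtain ⟨h1, h2⟩ := Prod.mk.inj hq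
  refine Subtype.ext (Prod.ext h1 ?_)
  refine (p.2.1.eq_of_eqOn_reached q.2.1 fun s hs => ?_).symm
  exact (congrFun h2 ⟨s, hs⟩).symm

/-- The separating functions are the coordinates of the point of the Hilbert cube and the values of
the branch, with weights decreasing geometrically along the branch. As a branch has at most one node
of each length, the sums of squares are bounded. -/
theorem isUniformEberleinCompact_space : IsUniformEberleinCompact T.space := by
  let f : ℕ ⊕ List Label → T.space → ℝ := Sum.elim (fun n q => (1 / 2) ^ n * (q.1.1 n : ℝ))
    fun s q => (1 / 2) ^ s.length * q.1.2 s
  have hgeom : ∀ J : Finset ℕ, ∑ n ∈ J, ((1 / 4 : ℝ)) ^ n ≤ 4 / 3 := by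
    intro J
    refine (Summable.sum_le_tsum J (fun n _ => by positivity)
      (summable_geometric_of_lt_one (by norm_num) (by norm_num))).trans ?_
    rw [tsum_geometric_of_lt_one (by norm_num) (by norm_num)]
    norm_num
  have hsq : ∀ n : ℕ, ((1 / 2 : ℝ) ^ n) ^ 2 = (1 / 4) ^ n := by
    intro n
    rw [← pow_mul, mul_comm, pow_mul]
    norm_num
  refine .of_separating f ?_ ?_ (4 / 3 + 4 * (4 / 3)) ?_
  · rintro (n | s)
    · change Continuous fun q : T.space => (1 / 2 : ℝ) ^ n * (q.1.1 n : ℝ)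
      fun_prop
    · exact continuous_const.mul (continuous_eval s)
  · intro p q h
    refine Subtype.ext (Prod.ext (funext fun n => Subtype.ext ?_) (funext fun s => ?_))
    · exact mul_left_cancel₀ (by positivity) (h (.inl n))
    · exact mul_left_cancel₀ (by positivity) (h (.inr s))
  · intro p J
    rw [Finset.sum_sum_eq_sum_toLeft_add_sum_toRight]
    refine add_le_add ?_ ?_
    · refine le_trans (Finset.sum_le_sum fun n _ => ?_) (hgeom J.toLeft)
      change ((1 / 2 : ℝ) ^ n * (p.1.1 n : ℝ)) ^ 2 ≤ _
      rw [mul_pow, hsq]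
      have h0 := (p.1.1 n).2.1
      have h1 := (p.1.1 n).2.2
      exact mul_le_of_le_one_right (by positivity) (pow_le_one₀ h0 h1)
    · classical
      let J' : Finset (List Label) := J.toRight.filter fun s => p.1.2 s ≠ 0
      have hJ' : ∀ s ∈ J', p.1.2 s ≠ 0 := fun s hs => (Finset.mem_filter.1 hs).2
      have hsupp : ∑ s ∈ J.toRight, f (.inr s) p ^ 2 = ∑ s ∈ J', f (.inr s) p ^ 2 := by
        refine (Finset.sum_filter_of_ne (p := fun s => p.1.2 s ≠ 0) fun s _ hs h0 => hs ?_).symm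
        simp [f, h0]
      have hinj : InjOn List.length (J' : Set (List Label)) := fun s hs t ht hst =>
        p.2.1.injOn_length (p.2.1.mem_reached (hJ' s hs)) (p.2.1.mem_reached (hJ' t ht)) hst
      rw [hsupp]
      calc _ ≤ ∑ s ∈ J', 4 * (1 / 4 : ℝ) ^ s.length := by
            refine Finset.sum_le_sum fun s hs => ?_
            change ((1 / 2 : ℝ) ^ s.length * p.1.2 s) ^ 2 ≤ _
            obtain ⟨h1, h2⟩ := (p.2.1.value s).resolve_left (hJ' s hs)
            rw [mul_pow, hsq, mul_comm]
            gcongr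
            nlinarith
        _ = 4 * ∑ n ∈ J'.image List.length, (1 / 4 : ℝ) ^ n := by
            rw [← Finset.mul_sum, Finset.sum_image hinj]
        _ ≤ 4 * (4 / 3) := by
            gcongr
            exact hgeom _

end Scheme

end

theorem theorem4p2 :
    (∀ (X : Type u) [TopologicalSpace X] [CompactSpace X] [T2Space X],
      E0 X ℝ = Set.univ →
        ∀ (M : Type v) [MetricSpace M], MemF M → E0 X M = Set.univ) ∧
    (∃ (X : Type) (_ : TopologicalSpace X),
      IsUniformEberleinCompact X ∧ FirstCountableTopology X ∧
        E0 X ℝ = Set.univ ∧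
        ∀ (M : Type v) [MetricSpace M] [CompactSpace M], ¬ MemF M → E0 X M ≠ Set.univ) := by
  obtain ⟨T⟩ := nonempty_scheme
  exact ⟨fun X _ _ _ hX M _ hM => E0_eq_univ_of_memF hX hM,
    T.space, inferInstance, T.isUniformEberleinCompact_space, inferInstance,
    Scheme.E0_real_eq_univ, fun M _ _ hM => Scheme.E0_ne_univ hM⟩
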